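/- Let $\Sigma$ be a finite alphabet. A \emph{tree stack} over a finite alphabet $C$ (with $@\notin C$) is a pair $(\xi,\rho)$, where $\xi$ is a partial function from $\mathbb N_+^*$ to $C\sqcup\{@\}$ with finite prefix-closed domain such that $\xi(\nu)=@$ if and only if $\nu=\varepsilon$, and $\rho\in\operatorname{dom}(\xi)$ is the \emph{pointer}. The \emph{instructions} are the following partial functions on tree stacks ($n\in\mathbb N_+$, $c\in C$): $\operatorname{id}$; $\operatorname{push}_n(c)$, defined if $\rho n\notin\operatorname{dom}(\xi)$, which adds the vertex $\rho n$ with label $c$ and moves the pointer to it; $\operatorname{up}_n$, defined if $\rho n\in\operatorname{dom}(\xi)$, which moves the pointer to $\rho n$; $\operatorname{down}$, defined if $\rho\ne\varepsilon$, which moves the pointer to its parent; $\operatorname{set}(c)$, defined if $\rho\neq\varepsilon$, which relabels $\rho$ by $c$. A \emph{tree stack automaton} (TSA) over $\Sigma$ consists of a finite state set $Q$, a finite alphabet $C$, an initial state $q_0\in Q$, a set of final states $Q_f\subseteq Q$, and a finite set $\delta$ of transitions $(q,x,p,f,q')$ with $q,q'\in Q$, $x\in\Sigma\cup\{\varepsilon\}$,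 $p$ a predicate ($\operatorname{true}$, or $\operatorname{eq}(c)$ with $c\in C\sqcup\{@\}$, which holds if $\xi(\rho)=c$), and $f$ an instruction. It starts in state $q_0$ with the tree stack $(\{(\varepsilon,@)\},\varepsilon)$; a \emph{run} is a finite sequence of transitions that can be applied one after the other, and it is \emph{accepting} if it ends in a state of $Q_f$. The language of the TSA is the set of the words $w\in\Sigma^*$ read by accepting runs. A run is \emph{$1$-restricted} if every address $\nu'n$ ($\nu'\in\mathbb N_+^*$, $n\in\mathbb N_+$) is entered at most once by a $\operatorname{push}_n(c)$ or $\operatorname{up}_n$ instruction applied when the pointer is at $\nu'$. A TSA is \emph{$1$-restricted} if each word in its language is read by an accepting $1$-restricted run. A \emph{pushdown automaton} (PDA) over $\Sigma$ consists of a finite state set $Q$, a finite stack alphabet $\Gamma$ with a bottom symbol $@\in\Gamma$, an initial state $q_0\in Q$, final states $Q_f\subseteq Q$, and a finite set of transitions $(q_1,x,\operatorname{push}(z,s),q_2)$ and $(q_1,x,\operatorname{pop}(t),q_2)$ with $q_1,q_2\in Q$, $x\in\Sigma\cup\{\varepsilon\}$, $z\in\Gamma$, $s\in(\Gamma\setminus\{@\})\cup\{\varepsilon\}$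 and $t\in\Gamma\setminus\{@\}$. Here $\operatorname{push}(z,s)$ is applicable if $z$ is the top of the stack, and puts $s$ on top of it; $\operatorname{pop}(t)$ is applicable if $t$ is the top of the stack, and removes it. The PDA starts in $q_0$ with the stack $@$ and accepts $w\in\Sigma^*$ if some sequence of transitions reads $w$ and ends in a state of $Q_f$ (with any stack). \textbf{Theorem.} For every language $L\subseteq\Sigma^*$ the following are equivalent: (1) $L$ is the language of a $1$-restricted TSA; (2) $L$ is the language of a TSA none of whose transitions contains an instruction $\operatorname{up}_n$; (3) $L$ is the language of a PDA; (4) $L$ is context-free, i.e. generated by a context-free grammar. -/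

import Mathlib

/-! ### Tree stacks -/

/-- The set `C ⊔ {@}` of vertex labels, `root` being the extra symbol `@`. -/
inductive TreeLabel (C : Type) where
  | root
  | lab (c : C)

/-- An address, i.e. a finite word over the positive integers. The children of the vertex `ν`
are the vertices `ν ++ [n]`. -/
abbrev Address := List ℕ+

/-- A tree with labels in `C`: a partial function from addresses to `C ⊔ {@}` (`none` meaning
"undefined") with a finite prefix-closed domain, taking the value `@` exactly at the empty
address (so that the domain is non-empty). -/
@[ext]
structure LabelledTree (C : Type) where
  label : Address → Option (TreeLabel C)
  finite_dom : {ν | label ν ≠ none}.Finite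
  prefix_closed : ∀ ν μ : Address, ν <+: μ → label μ ≠ none → label ν ≠ none
  root_iff : ∀ ν : Address, label ν = some TreeLabel.root ↔ ν = []

namespace LabelledTree

variable {C : Type}

/-- The domain (vertex set) of a tree. -/
def dom (ξ : LabelledTree C) : Set Address := {ν | ξ.label ν ≠ none}

/-- The tree that consists of the root only. -/
def single (C : Type) : LabelledTree C where
  label ν := if ν = [] then some TreeLabel.root else none
  finite_dom := by
    refine (Set.finite_singleton ([] : Address)).subset ?_
    intro ν hν
    by_contra h
    simp_all
  prefix_closed := by
    intro ν μ h hμ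
    by_cases hm : μ = []
    · subst hm
      simp_all
    · simp [hm] at hμ
  root_iff := by
    intro ν
    by_cases h : ν = [] <;> simp [h]

/-- Give the label `c` to the address `ν n`, whose parent `ν` is a vertex. The address `ν n`
may, but need not, be a vertex already. -/
def assign (ξ : LabelledTree C) (ν : Address) (hν : ν ∈ ξ.dom) (n : ℕ+) (c : C) :
    LabelledTree C where
  label := Function.update ξ.label (ν ++ [n]) (some (TreeLabel.lab c))
  finite_dom := by
    refine (ξ.finite_dom.insert (ν ++ [n])).subset ?_
    intro μ hμ
    by_cases h : μ = ν ++ [n]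
    · exact Or.inl h
    · right
      simpa [Function.update_of_ne h] using hμ
  prefix_closed := by
    intro μ κ h hκ
    by_cases hμ : μ = ν ++ [n]
    · simp [hμ]
    rw [Function.update_of_ne hμ]
    by_cases h' : κ = ν ++ [n]
    · subst h'
      rcases List.prefix_concat_iff.1 h with h1 | h1
      · exact absurd h1 hμ
      · exact ξ.prefix_closed _ _ h1 hν
    · rw [Function.update_of_ne h'] at hκ
      exact ξ.prefix_closed _ _ h hκ
  root_iff := by
    intro μ
    by_cases hμ : μ = ν ++ [n]
    · simp [hμ]
    · rw [Function.update_of_ne hμ]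
      exact ξ.root_iff μ

end LabelledTree

/-- A tree stack over `C`: a tree with labels in `C` and a pointer to one of its vertices. -/
@[ext]
structure TreeStack (C : Type) where
  tree : LabelledTree C
  pointer : Address
  pointer_mem : pointer ∈ tree.dom

namespace TreeStack

variable {C : Type}

/-- The initial tree stack `({(ε, @)}, ε)`. -/
def init (C : Type) : TreeStack C where
  tree := LabelledTree.single C
  pointer := []
  pointer_mem := by simp [LabelledTree.single, LabelledTree.dom]

/-- `push_n(c)`: defined if `ρ n` is not a vertex; adds the vertex `ρ n` with label `c` and moves
the pointer from `ρ` to it. -/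
def push (S : TreeStack C) (n : ℕ+) (c : C) : Option (TreeStack C) :=
  if S.tree.label (S.pointer ++ [n]) = none then
    some { tree := S.tree.assign S.pointer S.pointer_mem n c
           pointer := S.pointer ++ [n]
           pointer_mem := by simp [LabelledTree.assign, LabelledTree.dom] }
  else none

/-- `up_n`: defined if `ρ n` is a vertex; moves the pointer from `ρ` to `ρ n`. -/
def up (S : TreeStack C) (n : ℕ+) : Option (TreeStack C) :=
  if h : S.tree.label (S.pointer ++ [n]) ≠ none then
    some { tree := S.tree, pointer := S.pointer ++ [n], pointer_mem := h }
  else none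

theorem dropLast_mem (S : TreeStack C) : S.pointer.dropLast ∈ S.tree.dom :=
  S.tree.prefix_closed _ _ (List.dropLast_prefix _) S.pointer_mem

/-- `down`: defined if the pointer is not at the root; moves it to the parent vertex. -/
def down (S : TreeStack C) : Option (TreeStack C) :=
  if S.pointer ≠ [] then
    some { tree := S.tree, pointer := S.pointer.dropLast, pointer_mem := S.dropLast_mem }
  else none

/-- `set(c)`: defined if the pointer is not at the root; relabels the vertex `ρ` by `c`. -/
def set (S : TreeStack C) (c : C) : Option (TreeStack C) :=
  if h : S.pointer ≠ [] then
    some { tree := S.tree.assign S.pointer.dropLast S.dropLast_mem (S.pointer.getLast h) c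
           pointer := S.pointer
           pointer_mem := by
             simp [LabelledTree.assign, LabelledTree.dom, List.dropLast_append_getLast] }
  else none

end TreeStack

/-! ### Tree stack automata -/

/-- The predicates of a tree stack automaton: `eq(c)` for `c ∈ C ⊔ {@}`, and `true`. -/
inductive TSPredicate (C : Type) where
  | eq (c : TreeLabel C)
  | always

/-- The tree stacks for which a predicate is true. -/
def TSPredicate.Holds {C : Type} : TSPredicate C → TreeStack C → Prop
  | .eq c, S => S.tree.label S.pointer = some c
  | .always, _ => True

/-- The instructions of a tree stack automaton. -/
inductive TSInstruction (C : Type) where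
  | id
  | push (n : ℕ+) (c : C)
  | up (n : ℕ+)
  | down
  | set (c : C)

/-- The partial function on tree stacks denoted by an instruction. -/
def TSInstruction.apply {C : Type} : TSInstruction C → TreeStack C → Option (TreeStack C)
  | .id, S => some S
  | .push n c, S => S.push n c
  | .up n, S => S.up n
  | .down, S => S.down
  | .set c, S => S.set c

/-- A transition rule `(q, x, p, f, q')`; the input `none` is the empty word. -/
structure TSTransition (Q C : Type) (T : Type*) where
  source : Q
  input : Option T
  pred : TSPredicate C
  instr : TSInstruction C
  target : Q

/-- A tree stack automaton with terminal alphabet `T`. (State sets and label alphabets are finite,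
so it is no restriction to take them in `Type`.) -/
structure TSA (T : Type*) where
  State : Type
  TLabel : Type
  finite_state : Finite State
  finite_label : Finite TLabel
  start : State
  transitions : Set (TSTransition State TLabel T)
  finite_transitions : transitions.Finite
  final : Set State

namespace TSA

variable {T : Type*} (A : TSA T)

/-- The transitions of the ambient type of `A` (not necessarily rules of `A`). -/
abbrev Transition := TSTransition A.State A.TLabel T

/-- `A.Run q S τs q' S'`: the sequence `τs` of transition rules of `A` can be applied, one after
the other, in state `q` with tree stack `S`, and leads to state `q'` with tree stack `S'`. -/
inductive Run : A.State → TreeStack A.TLabel → List A.Transition →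
    A.State → TreeStack A.TLabel → Prop
  | nil (q : A.State) (S : TreeStack A.TLabel) : Run q S [] q S
  | cons {τ : A.Transition} {S S' S'' : TreeStack A.TLabel} {τs : List A.Transition}
      {q : A.State} (mem : τ ∈ A.transitions) (holds : τ.pred.Holds S)
      (step : τ.instr.apply S = some S') (rest : Run τ.target S' τs q S'') :
      Run τ.source S (τ :: τs) q S''

/-- The word over `T` read by a sequence of transitions. -/
def read (τs : List A.Transition) : List T := τs.filterMap (fun τ => τ.input)

/-- `τs` is a run from the initial configuration that ends in a final state and reads `w`. -/
def IsAcceptingRun (τs : List A.Transition) (w : List T) : Prop :=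
  (∃ q ∈ A.final, ∃ S, A.Run A.start (TreeStack.init A.TLabel) τs q S) ∧ A.read τs = w

/-- The language accepted by `A`. -/
def language : Language T := {w | ∃ τs, A.IsAcceptingRun τs w}

variable {A}

/-- The vertex `ν` is visited from below by `τ` when `τ` is applied to the tree stack `S`: the
instruction of `τ` moves the pointer from the parent of `ν` to `ν` by a push or an up. -/
def VisitsFromBelow (τ : A.Transition) (S : TreeStack A.TLabel) (ν : Address) : Prop :=
  ∃ n : ℕ+, ν = S.pointer ++ [n] ∧ ((∃ c, τ.instr = .push n c) ∨ τ.instr = .up n)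

open Classical in
/-- The number of transitions in `τs` that visit `ν` from below, when the sequence `τs` is
applied to the tree stack `S`. -/
noncomputable def visits (ν : Address) : TreeStack A.TLabel → List A.Transition → ℕ
  | _, [] => 0
  | S, τ :: τs =>
    (if VisitsFromBelow τ S ν then 1 else 0) +
      match τ.instr.apply S with
      | some S' => visits ν S' τs
      | none => 0

/-- A run from the initial configuration is `k`-restricted if every non-root address is visited
from below at most `k` times. -/
def IsRestrictedRun (k : ℕ) (τs : List A.Transition) : Prop :=
  ∀ ν : Address, ν ≠ [] → visits ν (TreeStack.init A.TLabel) τs ≤ k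

variable (A)

/-- A tree stack automaton is `k`-restricted if each word that it accepts has an accepting run
that is `k`-restricted. -/
def IsRestricted (k : ℕ) : Prop :=
  ∀ w ∈ A.language, ∃ τs, A.IsAcceptingRun τs w ∧ IsRestrictedRun k τs

/-- No transition rule contains an `up` instruction. -/
def UpFree : Prop := ∀ τ ∈ A.transitions, ∀ n : ℕ+, τ.instr ≠ .up n

end TSA

/-! ### Pushdown automata -/

/-- The stack operations: `push z s` requires `z` on top of the stack and puts `s` on top of it
(nothing, if `s` is `none`, that is, the empty word); `pop t` requires `t` on top of the stack and
removes it. -/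
inductive PDAOp (Γ : Type) where
  | push (z : Γ) (s : Option Γ)
  | pop (t : Γ)

/-- The partial function on stacks denoted by an operation, as a relation. A stack is a list, its
head being the top of the stack. -/
inductive PDAOp.Applies {Γ : Type} : PDAOp Γ → List Γ → List Γ → Prop
  | push (z : Γ) (s : Option Γ) (γ : List Γ) :
      Applies (.push z s) (z :: γ) (s.toList ++ z :: γ)
  | pop (t : Γ) (γ : List Γ) : Applies (.pop t) (t :: γ) γ

/-- A transition `(q₁, x, op, q₂)`; the input `none` is the empty word. -/
structure PDATransition (Q Γ : Type) (T : Type*) where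
  source : Q
  input : Option T
  op : PDAOp Γ
  target : Q

/-- A pushdown automaton with terminal alphabet `T`; the bottom of stack symbol is neither pushed
nor popped. -/
structure PDA (T : Type*) where
  State : Type
  StackSymbol : Type
  finite_state : Finite State
  finite_stackSymbol : Finite StackSymbol
  bottom : StackSymbol
  transitions : Set (PDATransition State StackSymbol T)
  finite_transitions : transitions.Finite
  push_ne_bottom : ∀ τ ∈ transitions, ∀ z s, τ.op = .push z (some s) → s ≠ bottom
  pop_ne_bottom : ∀ τ ∈ transitions, ∀ t, τ.op = .pop t → t ≠ bottom
  start : State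
  final : Set State

namespace PDA

variable {T : Type*} (P : PDA T)

/-- `P.Run q γ w q' γ'`: in state `q` with stack `γ`, the automaton can perform a sequence of
transitions that reads the word `w` and leads to state `q'` with stack `γ'`. -/
inductive Run : P.State → List P.StackSymbol → List T → P.State → List P.StackSymbol → Prop
  | nil (q : P.State) (γ : List P.StackSymbol) : Run q γ [] q γ
  | cons {τ : PDATransition P.State P.StackSymbol T} {γ γ' γ'' : List P.StackSymbol}
      {w : List T} {q : P.State} (mem : τ ∈ P.transitions) (step : τ.op.Applies γ γ')
      (rest : Run τ.target γ' w q γ'') :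
      Run τ.source γ (τ.input.toList ++ w) q γ''

/-- The language accepted by `P` (by final state; the stack need not be emptied). -/
def language : Language T := {w | ∃ q ∈ P.final, ∃ γ, P.Run P.start [P.bottom] w q γ}

end PDA

/-! The equivalence rests on one observation: no instruction deletes a vertex, and `push` needs an
absent one. Without `up`, every address is therefore entered at most once. Conversely, a vertex
other than the root that is present in a run has already been entered, so a 1-restricted run cannot
contain an `up` (`UpFree.visits_le`, `Run.instr_ne_up`), and deleting the `up` rules of a
1-restricted automaton keeps its language.

Without `up`, a vertex left by `down` is never seen again; all that survives of it is that its index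
is blocked for later pushes. Hence only the path from the root to the pointer matters, each vertex
on it carrying its label and the set of its used child indices. Finitely many indices occur in
`push` rules, so these data range over a finite set and the path is a pushdown stack
(`exists_pdaRule`, `exists_step_of_pdaRule`).

Pushdown automata become grammars by the triple construction, with an extra kind of nonterminal for
stack symbols that are never removed, since acceptance is by final state. Soundness interprets the
nonterminals by sets of computations (`GrammarRule.mem_segment`); completeness cuts an accepting
computation at the removals of stack symbols (`Run.decomposes`).

Finally, a tree stack automaton can traverse a derivation tree depth first, storing in each vertex
the rest of the right-hand side to resume after returning. The child index is one more than the
length of that rest. It decreases from one sibling to the next, so every push meets a free address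
and no `up` is needed (`yields_of_run`, `Yields.exists_run`). -/

/-! ### Instructions in terms of labels and pointers -/

namespace TreeStack

variable {C : Type} {S S' : TreeStack C} {n : ℕ+} {c : C}

theorem ext_label (ht : S.tree.label = S'.tree.label) (hp : S.pointer = S'.pointer) : S = S' :=
  TreeStack.ext (LabelledTree.ext ht) hp

theorem push_eq_some_iff : S.push n c = some S' ↔
    S.tree.label (S.pointer ++ [n]) = none ∧
    S'.tree.label = Function.update S.tree.label (S.pointer ++ [n]) (some (.lab c)) ∧
    S'.pointer = S.pointer ++ [n] := by
  unfold push
  split_ifs with h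
  · constructor
    · intro e
      obtain rfl := Option.some.inj e
      exact ⟨h, rfl, rfl⟩
    · rintro ⟨-, ht, hp⟩
      exact congrArg some (ext_label ht.symm hp.symm)
  · simp [h]

theorem up_eq_some_iff : S.up n = some S' ↔
    S.tree.label (S.pointer ++ [n]) ≠ none ∧ S'.tree.label = S.tree.label ∧
    S'.pointer = S.pointer ++ [n] := by
  unfold up
  split_ifs with h
  · constructor
    · intro e
      obtain rfl := Option.some.inj e
      exact ⟨h, rfl, rfl⟩
    · rintro ⟨-, ht, hp⟩
      exact congrArg some (ext_label ht.symm hp.symm)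
  · simp [h]

theorem down_eq_some_iff : S.down = some S' ↔
    S.pointer ≠ [] ∧ S'.tree.label = S.tree.label ∧ S'.pointer = S.pointer.dropLast := by
  unfold down
  split_ifs with h
  · constructor
    · intro e
      obtain rfl := Option.some.inj e
      exact ⟨h, rfl, rfl⟩
    · rintro ⟨-, ht, hp⟩
      exact congrArg some (ext_label ht.symm hp.symm)
  · simp [h]

theorem set_eq_some_iff : S.set c = some S' ↔
    S.pointer ≠ [] ∧
    S'.tree.label = Function.update S.tree.label S.pointer (some (.lab c)) ∧
    S'.pointer = S.pointer := by
  unfold set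
  split_ifs with h
  · constructor
    · intro e
      obtain rfl := Option.some.inj e
      refine ⟨h, ?_, rfl⟩
      simp [LabelledTree.assign, List.dropLast_append_getLast]
    · rintro ⟨-, ht, hp⟩
      refine congrArg some (ext_label ?_ hp.symm)
      simp [LabelledTree.assign, List.dropLast_append_getLast, ht]
  · simp [h]

theorem exists_push (h : S.tree.label (S.pointer ++ [n]) = none) (c : C) :
    ∃ S', S.push n c = some S' := by
  simp [push, h]

theorem exists_down (h : S.pointer ≠ []) : ∃ S', S.down = some S' := by
  simp [down, h]

theorem exists_set (h : S.pointer ≠ []) (c : C) : ∃ S', S.set c = some S' := by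
  simp [set, h]

/-- The children of an address that is not a vertex are not vertices. -/
theorem _root_.LabelledTree.label_append_eq_none {ξ : LabelledTree C} {ν : Address}
    (h : ξ.label ν = none) (μ : Address) : ξ.label (ν ++ μ) = none := by
  by_contra h'
  exact ξ.prefix_closed _ _ (List.prefix_append ν μ) h' h

end TreeStack

/-! ### Restricted runs and runs without `up` -/

namespace TSA

variable {T : Type*} {A : TSA T}

theorem read_cons (τ : A.Transition) (τs : List A.Transition) :
    A.read (τ :: τs) = τ.input.toList ++ A.read τs := by
  unfold read
  cases h : τ.input <;> simp [h]

/-- No instruction deletes a vertex and only `push` creates one; an `up` enters a vertex that is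
present already, so it fits the same formula. -/
theorem mem_dom_apply_iff {τ : A.Transition} {S S' : TreeStack A.TLabel}
    (h : τ.instr.apply S = some S') (ν : Address) :
    ν ∈ S'.tree.dom ↔ ν ∈ S.tree.dom ∨ VisitsFromBelow τ S ν := by
  obtain ⟨q, x, p, f, q'⟩ := τ
  change f.apply S = some S' at h
  simp only [VisitsFromBelow, LabelledTree.dom, Set.mem_ofPred_eq]
  cases f with
  | id =>
    obtain rfl := Option.some.inj h
    simp
  | push n c =>
    obtain ⟨h0, ht, -⟩ := TreeStack.push_eq_some_iff.1 h
    rw [ht]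
    by_cases hν : ν = S.pointer ++ [n]
    · simp [hν]
    · simp [hν]
  | up n =>
    obtain ⟨h0, ht, -⟩ := TreeStack.up_eq_some_iff.1 h
    rw [ht]
    by_cases hν : ν = S.pointer ++ [n]
    · simp [hν, h0]
    · simp [hν]
  | down =>
    obtain ⟨h0, ht, -⟩ := TreeStack.down_eq_some_iff.1 h
    simp [ht]
  | set c =>
    obtain ⟨h0, ht, -⟩ := TreeStack.set_eq_some_iff.1 h
    rw [ht]
    by_cases hν : ν = S.pointer
    · have := S.pointer_mem
      simp only [LabelledTree.dom, Set.mem_ofPred_eq] at this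
      simp [hν, this]
    · simp [Function.update_of_ne hν]

open Classical in
theorem visits_cons {τ : A.Transition} {S S' : TreeStack A.TLabel}
    (h : τ.instr.apply S = some S') (ν : Address) (τs : List A.Transition) :
    visits ν S (τ :: τs) = (if VisitsFromBelow τ S ν then 1 else 0) + visits ν S' τs := by
  simp [visits, h]

/-- If no transition rule contains an `up`, then every address is entered at most once, and the
present vertices are not entered at all. -/
theorem UpFree.visits_le (hA : A.UpFree) {q q' : A.State} {S S' : TreeStack A.TLabel}
    {τs : List A.Transition} (h : A.Run q S τs q' S') (ν : Address) :
    visits ν S τs ≤ 1 ∧ (ν ∈ S.tree.dom → visits ν S τs = 0) := by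
  induction h with
  | nil q S => simp [visits]
  | @cons τ S S₁ S₂ τs q mem holds step rest ih =>
    rw [visits_cons step]
    have hdom := mem_dom_apply_iff step ν
    by_cases hv : VisitsFromBelow τ S ν
    · have h0 := ih.2 (hdom.2 (Or.inr hv))
      refine ⟨by simp [h0, hv], fun hν => ?_⟩
      obtain ⟨n, rfl, ⟨c, hc⟩ | hn⟩ := hv
      · rw [hc] at step
        exact absurd (TreeStack.push_eq_some_iff.1 step).1 hν
      · exact absurd hn (hA τ mem n)
    · simp only [hv, if_false, zero_add]
      exact ⟨ih.1, fun hν => ih.2 (hdom.2 (Or.inl hν))⟩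

theorem UpFree.isRestricted (hA : A.UpFree) : A.IsRestricted 1 := by
  rintro w ⟨τs, hτs⟩
  refine ⟨τs, hτs, fun ν _ => ?_⟩
  obtain ⟨⟨q, -, S, hrun⟩, -⟩ := hτs
  exact (hA.visits_le hrun ν).1

/-- A run that enters every address at most once, and the present vertices not at all, contains no
`up`. -/
theorem Run.instr_ne_up {q q' : A.State} {S S' : TreeStack A.TLabel} {τs : List A.Transition}
    (h : A.Run q S τs q' S') (hle : ∀ ν ≠ [], visits ν S τs ≤ 1)
    (hdom : ∀ ν ∈ S.tree.dom, ν ≠ [] → visits ν S τs = 0) :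
    ∀ τ ∈ τs, ∀ n, τ.instr ≠ .up n := by
  induction h with
  | nil q S => simp
  | @cons τ S S₁ S₂ τs q mem holds step rest ih =>
    simp only [visits_cons step] at hle hdom
    have hτ : ∀ n, τ.instr ≠ .up n := by
      intro n hn
      have h1 := step
      rw [hn] at h1
      -- The target of an `up` is already present, so by `hdom` it should not be entered at all.
      have h2 := hdom _ (TreeStack.up_eq_some_iff.1 h1).1 (by simp)
      rw [if_pos ⟨n, rfl, Or.inr hn⟩] at h2
      omega
    -- The condition on present vertices is inherited: a vertex entered by this step has used up its
    -- only visit.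
    have hrest := ih (fun ν hν => le_trans (Nat.le_add_left _ _) (hle ν hν)) (by
      intro ν hν hne
      rcases (mem_dom_apply_iff step ν).1 hν with h1 | h1
      · have := hdom ν h1 hne
        omega
      · have := hle ν hne
        rw [if_pos h1] at this
        omega)
    intro σ hσ
    rcases List.mem_cons.1 hσ with rfl | hσ
    · exact hτ
    · exact hrest σ hσ

variable (A)

/-- The automaton without its transitions that contain an `up`. -/
def dropUp : TSA T where
  __ := A
  transitions := {τ | τ ∈ A.transitions ∧ ∀ n, τ.instr ≠ .up n}
  finite_transitions := A.finite_transitions.subset fun _ h => h.1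

variable {A}

theorem dropUp_upFree : A.dropUp.UpFree := fun _ h => h.2

theorem Run.of_dropUp {q q' : A.dropUp.State} {S S' : TreeStack A.dropUp.TLabel}
    {τs : List A.dropUp.Transition} (h : A.dropUp.Run q S τs q' S') :
    Run A q S τs q' S' := by
  induction h with
  | nil q S => exact .nil (A := A) q S
  | cons mem holds step rest ih => exact .cons (A := A) mem.1 holds step ih

theorem Run.dropUp {q q' : A.State} {S S' : TreeStack A.TLabel} {τs : List A.Transition}
    (h : A.Run q S τs q' S') (hup : ∀ τ ∈ τs, ∀ n, τ.instr ≠ .up n) :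
    A.dropUp.Run q S τs q' S' := by
  induction h with
  | nil q S => exact Run.nil (A := A.dropUp) q S
  | cons mem holds step rest ih =>
    exact Run.cons (A := A.dropUp) ⟨mem, hup _ (by simp)⟩ holds step
      (ih fun τ hτ => hup τ (List.mem_cons_of_mem _ hτ))

/-- The initial tree has no vertex but the root, so a 1-restricted run satisfies the hypotheses of
`Run.instr_ne_up` and survives the removal of the `up` rules. -/
theorem IsRestricted.language_dropUp (hA : A.IsRestricted 1) :
    A.dropUp.language = A.language := by
  ext w
  constructor
  · rintro ⟨τs, ⟨q, hq, S, hrun⟩, hr⟩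
    exact ⟨τs, ⟨q, hq, S, Run.of_dropUp hrun⟩, hr⟩
  · intro hw
    obtain ⟨τs, ⟨⟨q, hq, S, hrun⟩, hr⟩, hres⟩ := hA w hw
    refine ⟨τs, ⟨q, hq, S, hrun.dropUp (hrun.instr_ne_up hres fun ν hν hne => ?_)⟩, hr⟩
    simp [TreeStack.init, LabelledTree.single, LabelledTree.dom, hne] at hν

end TSA

/-! ### Finiteness, and the data stored for the vertices of a path -/

instance TreeLabel.finite {C : Type} [Finite C] : Finite (TreeLabel C) :=
  Finite.of_surjective (fun o : Option C => o.elim TreeLabel.root TreeLabel.lab) fun l =>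
    match l with
    | .root => ⟨none, rfl⟩
    | .lab c => ⟨some c, rfl⟩

instance PDAOp.finite {Γ : Type} [Finite Γ] : Finite (PDAOp Γ) :=
  Finite.of_surjective
    (fun o : (Γ × Option Γ) ⊕ Γ => o.elim (fun a => PDAOp.push a.1 a.2) PDAOp.pop) fun l =>
    match l with
    | .push z s => ⟨.inl (z, s), rfl⟩
    | .pop t => ⟨.inr t, rfl⟩

instance PDATransition.finite {Q Γ : Type} {T : Type*} [Finite Q] [Finite Γ] [Finite T] :
    Finite (PDATransition Q Γ T) :=
  Finite.of_surjective
    (fun a : Q × Option T × PDAOp Γ × Q => (⟨a.1, a.2.1, a.2.2.1, a.2.2.2⟩ : PDATransition Q Γ T))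
    fun τ => ⟨(τ.source, τ.input, τ.op, τ.target), rfl⟩

/-- The truth value of a predicate, given the label of the pointer. -/
def TSPredicate.HoldsAt {C : Type} : TSPredicate C → Option (TreeLabel C) → Prop
  | .eq c, l => l = some c
  | .always, _ => True

theorem TSPredicate.holds_iff {C : Type} (p : TSPredicate C) (S : TreeStack C) :
    p.Holds S ↔ p.HoldsAt (S.tree.label S.pointer) := by
  cases p <;> rfl

namespace LabelledTree

variable {C : Type} (N : Set ℕ+) (ξ : LabelledTree C)

/-- The label of `ν` and the indices in `N` of the children of `ν`. -/
def info (ν : Address) : Option (TreeLabel C) × Set N :=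
  (ξ.label ν, {n | ξ.label (ν ++ [n.1]) ≠ none})

/-- The stack that holds the data of the proper ancestors of `ν`, on top of a bottom symbol. -/
def ancestors (ν : Address) : List (Option (Option (TreeLabel C) × Set N)) :=
  (List.range ν.length).reverse.map (fun i => some (ξ.info N (ν.take i))) ++ [none]

variable {N ξ}

/-- Moving the pointer to a child, or back, thus amounts to pushing or popping a single stack entry.
-/
theorem ancestors_append (ν : Address) (n : ℕ+) :
    ξ.ancestors N (ν ++ [n]) = some (ξ.info N ν) :: ξ.ancestors N ν := by
  unfold ancestors
  rw [List.length_append, List.length_singleton, List.range_succ]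
  simp only [List.reverse_append, List.reverse_singleton, List.map_cons,
    List.cons_append, List.take_left']
  congr 2
  refine List.map_congr_left fun i hi => ?_
  have hi' : i < ν.length := by simpa using hi
  rw [List.take_append_of_le_length hi'.le]

/-- Length alone suffices as the criterion: `push` and `set` change no data at addresses shorter
than the old pointer. -/
theorem ancestors_congr {ξ' : LabelledTree C} {ν : Address}
    (h : ∀ μ : Address, μ.length < ν.length → ξ.info N μ = ξ'.info N μ) :
    ξ.ancestors N ν = ξ'.ancestors N ν := by
  unfold ancestors
  congr 1
  refine List.map_congr_left fun i hi => ?_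
  have hi' : i < ν.length := by simpa using hi
  rw [h _ (by rw [List.length_take]; omega)]

variable {ξ' : LabelledTree C} {ν : Address} {l : TreeLabel C}

/-- Relabelling an address affects the data of its parent and of itself only. -/
theorem info_of_update_of_ne (h : ξ'.label = Function.update ξ.label ν (some l)) {μ : Address}
    (h1 : μ ≠ ν) (h2 : ∀ n, μ ++ [n] ≠ ν) : ξ'.info N μ = ξ.info N μ := by
  unfold info
  rw [h, Function.update_of_ne h1]
  congr 1
  ext n
  simp [Function.update_of_ne (h2 n.1)]

theorem info_of_update_self (h : ξ'.label = Function.update ξ.label ν (some l)) :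
    ξ'.info N ν = (some l, (ξ.info N ν).2) := by
  unfold info
  rw [h, Function.update_self]
  congr 1
  ext n
  simp

theorem info_of_update_parent {μ : Address} {n : N}
    (h : ξ'.label = Function.update ξ.label (μ ++ [n.1]) (some l)) :
    ξ'.info N μ = ((ξ.info N μ).1, insert n (ξ.info N μ).2) := by
  unfold info
  rw [h, Function.update_of_ne (by simp)]
  congr 1
  ext m
  by_cases hm : m = n
  · simp [hm]
  · have : m.1 ≠ n.1 := fun e => hm (Subtype.ext e)
    simp [Function.update_apply, hm, this]

/-- Relabelling a vertex that exists already creates no child, so even the data of its parent are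
unaffected. -/
theorem info_of_update_vertex (hν : ξ.label ν ≠ none)
    (h : ξ'.label = Function.update ξ.label ν (some l)) {μ : Address} (h1 : μ ≠ ν) :
    ξ'.info N μ = ξ.info N μ := by
  unfold info
  rw [h, Function.update_of_ne h1]
  congr 1
  ext n
  by_cases hn : μ ++ [n.1] = ν
  · simp [hn, hν]
  · simp [Function.update_of_ne hn]

end LabelledTree

/-! ### From automata without `up` to pushdown automata -/

namespace TSA

variable {T : Type*} (A : TSA T)

/-- The indices of children that occur in the `push` instructions of `A`. -/
def indices : Set ℕ+ := {n | ∃ τ ∈ A.transitions, ∃ c, τ.instr = .push n c}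

theorem finite_indices : A.indices.Finite := by
  let index : TSInstruction A.TLabel → ℕ+
    -- The value at the other instructions is irrelevant; it only makes the function total.
    | .push n _ => n
    | _ => 1
  refine (A.finite_transitions.image fun τ => index τ.instr).subset ?_
  rintro n ⟨τ, hτ, c, hc⟩
  exact ⟨τ, hτ, by simp [hc, index]⟩

/-- The label of a vertex together with the set of the indices of its children. -/
abbrev VertexData := Option (TreeLabel A.TLabel) × Set A.indices

/-- The transitions of the pushdown automaton that keeps the data of the vertex under the pointer
in its state, and those of its proper ancestors on its stack. -/
inductive PDARule : PDATransition (A.State × A.VertexData) (Option A.VertexData) T → Prop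
  | id {τ : A.Transition} (i : A.VertexData) (z : Option A.VertexData)
      (mem : τ ∈ A.transitions) (holds : τ.pred.HoldsAt i.1) (instr : τ.instr = .id) :
      PDARule ⟨(τ.source, i), τ.input, .push z none, (τ.target, i)⟩
  | push {τ : A.Transition} (i : A.VertexData) (z : Option A.VertexData) (n : A.indices)
      (c : A.TLabel) (mem : τ ∈ A.transitions) (holds : τ.pred.HoldsAt i.1)
      (instr : τ.instr = .push n c) (unused : n ∉ i.2) :
      PDARule ⟨(τ.source, i), τ.input, .push z (some (some (i.1, insert n i.2))),
        (τ.target, (some (.lab c), ∅))⟩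
  | down {τ : A.Transition} (i j : A.VertexData) (mem : τ ∈ A.transitions)
      (holds : τ.pred.HoldsAt i.1) (instr : τ.instr = .down) :
      PDARule ⟨(τ.source, i), τ.input, .pop (some j), (τ.target, j)⟩
  | set {τ : A.Transition} (i : A.VertexData) (z : Option A.VertexData) (c : A.TLabel)
      (mem : τ ∈ A.transitions) (holds : τ.pred.HoldsAt i.1) (instr : τ.instr = .set c)
      (ne_root : i.1 ≠ some .root) :
      PDARule ⟨(τ.source, i), τ.input, .push z none, (τ.target, (some (.lab c), i.2))⟩

/-- The pushdown automaton that simulates the runs of `A` without `up`. -/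
def toPDA [Finite T] : PDA T :=
  haveI := A.finite_state
  haveI := A.finite_label
  haveI := A.finite_indices.to_subtype
  { State := A.State × A.VertexData
    StackSymbol := Option A.VertexData
    finite_state := inferInstance
    finite_stackSymbol := inferInstance
    bottom := none
    transitions := {σ | A.PDARule σ}
    finite_transitions := Set.toFinite _
    push_ne_bottom := by
      rintro _ (_ | _ | _ | _) z s h <;> simp at h
      rw [← h.2]
      simp
    pop_ne_bottom := by
      rintro _ (_ | _ | _ | _) t h <;> simp at h
      rw [← h]
      simp
    start := (A.start, (LabelledTree.single A.TLabel).info A.indices [])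
    final := {p | p.1 ∈ A.final} }

variable {A}

/-- The data of the vertex under the pointer. -/
def pointerData (S : TreeStack A.TLabel) : A.VertexData := S.tree.info A.indices S.pointer

/-- The data of the proper ancestors of the vertex under the pointer. -/
def ancestorData (S : TreeStack A.TLabel) : List (Option A.VertexData) :=
  S.tree.ancestors A.indices S.pointer

/-- The index of the new child is recorded in the parent's entry at the moment of the push, so it
stays blocked after the child's own data are forgotten. The new vertex has no children because the
domain is prefix-closed. -/
theorem data_push {S S' : TreeStack A.TLabel} {n : A.indices} {c : A.TLabel}
    (h : S.push n c = some S') :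
    n ∉ (pointerData S).2 ∧ pointerData S' = (some (.lab c), ∅) ∧
    ancestorData S' =
      some ((pointerData S).1, insert n (pointerData S).2) :: ancestorData S := by
  obtain ⟨h0, ht, hp⟩ := TreeStack.push_eq_some_iff.1 h
  refine ⟨by simpa [pointerData, LabelledTree.info] using h0, ?_, ?_⟩
  · unfold pointerData
    rw [hp, LabelledTree.info_of_update_self ht]
    congr 1
    ext m
    simp only [LabelledTree.info, Set.mem_ofPred_eq, Set.mem_empty_iff_false, iff_false, not_not]
    exact LabelledTree.label_append_eq_none h0 _
  · unfold ancestorData pointerData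
    rw [hp, LabelledTree.ancestors_append, LabelledTree.info_of_update_parent ht]
    congr 1
    refine LabelledTree.ancestors_congr fun μ hμ => LabelledTree.info_of_update_of_ne ht ?_ ?_
    · rintro rfl
      simp at hμ
    · intro m hm
      have := congrArg List.length hm
      simp at this
      omega

theorem data_down {S S' : TreeStack A.TLabel} (h : S.down = some S') :
    ancestorData S = some (pointerData S') :: ancestorData S' := by
  obtain ⟨h0, ht, hp⟩ := TreeStack.down_eq_some_iff.1 h
  have ht' : S'.tree = S.tree := LabelledTree.ext ht
  unfold ancestorData pointerData
  rw [hp, ht', ← LabelledTree.ancestors_append _ (S.pointer.getLast h0),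
    List.dropLast_append_getLast]

theorem data_set {S S' : TreeStack A.TLabel} {c : A.TLabel} (h : S.set c = some S') :
    (pointerData S).1 ≠ some .root ∧ pointerData S' = (some (.lab c), (pointerData S).2) ∧
    ancestorData S' = ancestorData S := by
  obtain ⟨h0, ht, hp⟩ := TreeStack.set_eq_some_iff.1 h
  refine ⟨fun e => h0 ((S.tree.root_iff _).1 e), ?_, ?_⟩
  · unfold pointerData
    rw [hp, LabelledTree.info_of_update_self ht]
  · unfold ancestorData
    rw [hp]
    refine LabelledTree.ancestors_congr fun μ hμ =>
      LabelledTree.info_of_update_vertex S.pointer_mem ht ?_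
    rintro rfl
    simp at hμ

theorem exists_ancestorData_eq_cons (S : TreeStack A.TLabel) :
    ∃ z γ, ancestorData S = z :: γ := by
  refine List.exists_cons_of_ne_nil ?_
  simp [ancestorData, LabelledTree.ancestors]

theorem pointer_ne_nil_of_ancestorData {S : TreeStack A.TLabel} {i : A.VertexData}
    {γ : List (Option A.VertexData)} (h : ancestorData S = some i :: γ) : S.pointer ≠ [] := by
  intro e
  simp [ancestorData, LabelledTree.ancestors, e] at h

/-- A step of `A` that is not an `up` is a step of the pushdown automaton. -/
theorem exists_pdaRule {τ : A.Transition} {S S' : TreeStack A.TLabel}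
    (mem : τ ∈ A.transitions) (holds : τ.pred.Holds S) (step : τ.instr.apply S = some S')
    (hup : ∀ n, τ.instr ≠ .up n) :
    ∃ op, A.PDARule ⟨(τ.source, pointerData S), τ.input, op, (τ.target, pointerData S')⟩ ∧
      op.Applies (ancestorData S) (ancestorData S') := by
  rw [TSPredicate.holds_iff] at holds
  -- The bottom symbol keeps the stack non-empty, and the rules allow every top symbol `z`, so
  -- inspecting the top never blocks the simulation.
  obtain ⟨z, γ, hz⟩ := exists_ancestorData_eq_cons S
  cases hf : τ.instr with
  | id =>
    rw [hf] at step
    obtain rfl := Option.some.inj step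
    refine ⟨_, .id _ z mem holds hf, ?_⟩
    rw [hz]
    exact .push z none γ
  | push n c =>
    rw [hf] at step
    have hn : n ∈ A.indices := ⟨τ, mem, c, hf⟩
    obtain ⟨h1, h2, h3⟩ := data_push (n := ⟨n, hn⟩) step
    rw [h2, h3]
    refine ⟨_, .push _ z ⟨n, hn⟩ c mem holds hf h1, ?_⟩
    rw [hz]
    exact .push z (some _) γ
  | up n => exact absurd hf (hup n)
  | down =>
    rw [hf] at step
    rw [data_down step]
    exact ⟨_, .down _ _ mem holds hf, .pop _ _⟩
  | set c =>
    rw [hf] at step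
    obtain ⟨h1, h2, h3⟩ := data_set step
    rw [h2, h3]
    refine ⟨_, .set _ z c mem holds hf h1, ?_⟩
    rw [hz]
    exact .push z none γ

/-- A step of the pushdown automaton is a step of `A`. -/
theorem exists_step_of_pdaRule
    {σ : PDATransition (A.State × A.VertexData) (Option A.VertexData) T}
    {q : A.State} {S : TreeStack A.TLabel} {γ : List (Option A.VertexData)} (hσ : A.PDARule σ)
    (source : σ.source = (q, pointerData S)) (step : σ.op.Applies (ancestorData S) γ) :
    ∃ τ ∈ A.transitions, ∃ S', τ.source = q ∧ τ.input = σ.input ∧ τ.pred.Holds S ∧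
      τ.instr.apply S = some S' ∧ σ.target = (τ.target, pointerData S') ∧
      γ = ancestorData S' := by
  cases hσ with
  | @id τ i z mem holds instr =>
    obtain ⟨rfl, rfl⟩ := Prod.mk.inj source
    refine ⟨τ, mem, S, rfl, rfl, (τ.pred.holds_iff S).2 holds, by rw [instr]; rfl, rfl, ?_⟩
    generalize ancestorData S = δ at step
    cases step
    rfl
  | @push τ i z n c mem holds instr unused =>
    obtain ⟨rfl, rfl⟩ := Prod.mk.inj source
    obtain ⟨S', hS'⟩ := TreeStack.exists_push (S := S) (n := n)
      (by simpa [pointerData, LabelledTree.info] using unused) c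
    obtain ⟨-, h2, h3⟩ := data_push hS'
    refine ⟨τ, mem, S', rfl, rfl, (τ.pred.holds_iff S).2 holds, by rw [instr]; exact hS',
      by rw [h2], ?_⟩
    rw [h3]
    generalize ancestorData S = δ at step
    cases step
    rfl
  | @down τ i j mem holds instr =>
    obtain ⟨rfl, rfl⟩ := Prod.mk.inj source
    have hj : ancestorData S = some j :: γ := by
      generalize ancestorData S = δ at step
      cases step
      rfl
    -- At the root the stack consists of the bottom symbol `none` only; a top entry `some j` shows
    -- that the pointer has a parent.
    obtain ⟨S', hS'⟩ := TreeStack.exists_down (pointer_ne_nil_of_ancestorData hj)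
    have h := data_down hS'
    rw [hj, List.cons.injEq, Option.some.injEq] at h
    exact ⟨τ, mem, S', rfl, rfl, (τ.pred.holds_iff S).2 holds, by rw [instr]; exact hS',
      by rw [h.1], h.2⟩
  | @set τ i z c mem holds instr ne_root =>
    obtain ⟨rfl, rfl⟩ := Prod.mk.inj source
    obtain ⟨S', hS'⟩ := TreeStack.exists_set (S := S)
      (fun e => ne_root ((S.tree.root_iff _).2 e)) c
    obtain ⟨-, h2, h3⟩ := data_set hS'
    refine ⟨τ, mem, S', rfl, rfl, (τ.pred.holds_iff S).2 holds, by rw [instr]; exact hS',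
      by rw [h2], ?_⟩
    rw [h3]
    generalize ancestorData S = δ at step
    cases step
    rfl

variable [Finite T]

theorem Run.toPDA {q q' : A.State} {S S' : TreeStack A.TLabel} {τs : List A.Transition}
    (h : A.Run q S τs q' S') (hA : A.UpFree) :
    A.toPDA.Run (q, pointerData S) (ancestorData S) (A.read τs)
      (q', pointerData S') (ancestorData S') := by
  induction h with
  | nil q S => exact PDA.Run.nil (P := A.toPDA) _ _
  | cons mem holds step rest ih =>
    obtain ⟨op, hrule, hop⟩ := exists_pdaRule mem holds step (hA _ mem)
    rw [read_cons]
    exact PDA.Run.cons (P := A.toPDA) hrule hop ih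

/-- A configuration of the pushdown automaton does not determine the abandoned subtrees, so a tree
stack `S` with the right data is carried through the induction. -/
theorem exists_run_of_toPDA {p p' : A.toPDA.State} {γ γ' : List A.toPDA.StackSymbol}
    {w : List T} (h : A.toPDA.Run p γ w p' γ') :
    ∀ (q : A.State) (S : TreeStack A.TLabel), p = (q, pointerData S) → γ = ancestorData S →
      ∃ τs S', A.Run q S τs p'.1 S' ∧ A.read τs = w := by
  induction h with
  | nil p γ =>
    rintro q S rfl -
    exact ⟨[], S, .nil q S, rfl⟩
  | cons mem step rest ih =>
    rintro q S hp rfl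
    obtain ⟨τ, hτ, S₁, rfl, hin, hholds, happ, htarget, hγ⟩ :=
      exists_step_of_pdaRule mem hp step
    obtain ⟨τs, S', hrun, hread⟩ := ih _ S₁ htarget hγ
    exact ⟨τ :: τs, S', .cons hτ hholds happ hrun, by rw [read_cons, hread, hin]⟩

theorem UpFree.language_toPDA (hA : A.UpFree) : A.toPDA.language = A.language := by
  ext w
  constructor
  · rintro ⟨p, hp, γ, hrun⟩
    obtain ⟨τs, S', h, hr⟩ := exists_run_of_toPDA hrun A.start (TreeStack.init _) rfl rfl
    exact ⟨τs, ⟨p.1, hp, S', h⟩, hr⟩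
  · rintro ⟨τs, ⟨q, hq, S, hrun⟩, rfl⟩
    exact ⟨(q, pointerData S), hq, _, hrun.toPDA hA⟩

end TSA

/-! ### Derivation trees of context-free grammars -/

namespace ContextFreeGrammar

variable {T : Type*} {g : ContextFreeGrammar T}

variable (g) in
/-- `g.Yields β w`: the word `w` is the yield of a sequence of derivation trees of `g` whose roots
form the string `β`. -/
inductive Yields : List (Symbol T g.NT) → List T → Prop
  | nil : Yields [] []
  | terminal (a : T) {β : List (Symbol T g.NT)} {w : List T} (h : Yields β w) :
      Yields (.terminal a :: β) (a :: w)
  | nonterminal {r : ContextFreeRule T g.NT} {β : List (Symbol T g.NT)} {u v : List T}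
      (mem : r ∈ g.rules) (hu : Yields r.output u) (hv : Yields β v) :
      Yields (.nonterminal r.input :: β) (u ++ v)

theorem Yields.append {α β : List (Symbol T g.NT)} {u v : List T} (hu : g.Yields α u)
    (hv : g.Yields β v) : g.Yields (α ++ β) (u ++ v) := by
  induction hu with
  | nil => exact hv
  | terminal a _ ih => exact .terminal a ih
  | nonterminal mem h _ _ ih =>
    rw [List.append_assoc]
    exact .nonterminal mem h ih

theorem Yields.exists_of_append {α β : List (Symbol T g.NT)} {w : List T}
    (h : g.Yields (α ++ β) w) : ∃ u v, g.Yields α u ∧ g.Yields β v ∧ w = u ++ v := by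
  induction α generalizing w with
  | nil => exact ⟨[], w, .nil, h, rfl⟩
  | cons x α ih =>
    cases h with
    | terminal a h =>
      obtain ⟨u, v, hu, hv, rfl⟩ := ih h
      exact ⟨a :: u, v, .terminal a hu, hv, rfl⟩
    | nonterminal mem h1 h =>
      obtain ⟨u, v, hu, hv, rfl⟩ := ih h
      exact ⟨_, v, .nonterminal mem h1 hu, hv, by rw [List.append_assoc]⟩

/-- A rewriting step is undone by grafting: the trees above the right-hand side are gathered under
one new root. -/
theorem Yields.of_rewrites {r : ContextFreeRule T g.NT} (mem : r ∈ g.rules)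
    {α β : List (Symbol T g.NT)} (h : r.Rewrites α β) {w : List T} (hβ : g.Yields β w) :
    g.Yields α w := by
  induction h generalizing w with
  | head s =>
    obtain ⟨u, v, hu, hv, rfl⟩ := hβ.exists_of_append
    exact .nonterminal mem hu hv
  | cons x _ ih =>
    cases hβ with
    | terminal a h => exact .terminal a (ih h)
    | nonterminal mem h1 h => exact .nonterminal mem h1 (ih h)

theorem yields_map_terminal (w : List T) : g.Yields (w.map .terminal) w := by
  induction w with
  | nil => exact .nil
  | cons a w ih => exact .terminal a ih

theorem Yields.derives {β : List (Symbol T g.NT)} {w : List T} (h : g.Yields β w) :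
    g.Derives β (w.map .terminal) := by
  induction h with
  | nil => rfl
  | terminal a _ ih => exact ih.append_left [.terminal a]
  | @nonterminal r β u v mem _ _ ihu ihv =>
    rw [List.map_append]
    have h1 : g.Produces (.nonterminal r.input :: β) (r.output ++ β) := ⟨r, mem, .head β⟩
    exact h1.trans_derives ((ihu.append_right β).trans (ihv.append_left _))

/-- This replaces sequences of rewriting steps by structural induction on trees. From right to left,
the derivation is read backwards from its terminal word. -/
theorem yields_iff_derives {β : List (Symbol T g.NT)} {w : List T} :
    g.Yields β w ↔ g.Derives β (w.map .terminal) := by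
  refine ⟨Yields.derives, fun h => ?_⟩
  induction h using Relation.ReflTransGen.head_induction_on with
  | refl => exact yields_map_terminal w
  | head h _ ih =>
    obtain ⟨r, mem, hr⟩ := h
    exact ih.of_rewrites mem hr

theorem mem_language_iff_yields {w : List T} :
    w ∈ g.language ↔ g.Yields [.nonterminal g.initial] w :=
  yields_iff_derives.symm

/-- An interpretation of the nonterminals by languages that satisfies all the rules is respected
by derivations. -/
theorem Yields.mem_prod (I : g.NT → Language T)
    (hI : ∀ r ∈ g.rules, ∀ w, w ∈ (r.output.map (Symbol.rec (fun a => {[a]}) I)).prod →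
      w ∈ I r.input)
    {β : List (Symbol T g.NT)} {w : List T} (h : g.Yields β w) :
    w ∈ (β.map (Symbol.rec (motive := fun _ => Language T) (fun a => {[a]}) I)).prod := by
  induction h with
  | nil => exact Language.nil_mem_one
  | terminal a _ ih =>
    rw [List.map_cons, List.prod_cons]
    exact Language.append_mem_mul (a := [a]) rfl ih
  | nonterminal mem _ _ ihu ihv =>
    rw [List.map_cons, List.prod_cons]
    exact Language.append_mem_mul (hI _ mem _ ihu) ihv

end ContextFreeGrammar

/-! ### From pushdown automata to grammars: the triple construction -/

namespace PDA

variable {T : Type*} (P : PDA T)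

/-- The nonterminals of the grammar of `P`: `(q, z, some p)` generates the words that lead from
`q` to `p` by removing `z` from the stack, and `(q, z, none)` those that lead from `q` to
acceptance without removing `z`. -/
abbrev Nonterminal := P.State × P.StackSymbol × Option P.State

/-- The rules of the grammar of `P`. -/
inductive GrammarRule : ContextFreeRule T P.Nonterminal → Prop
  | final {q : P.State} (z : P.StackSymbol) (hq : q ∈ P.final) : GrammarRule ⟨(q, z, none), []⟩
  | pop {q p : P.State} {x : Option T} {z : P.StackSymbol}
      (mem : ⟨q, x, .pop z, p⟩ ∈ P.transitions) :
      GrammarRule ⟨(q, z, some p), x.toList.map .terminal⟩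
  | stay {q p : P.State} {x : Option T} {z : P.StackSymbol} (o : Option P.State)
      (mem : ⟨q, x, .push z none, p⟩ ∈ P.transitions) :
      GrammarRule ⟨(q, z, o), x.toList.map .terminal ++ [.nonterminal (p, z, o)]⟩
  | push {q p : P.State} {x : Option T} {z s : P.StackSymbol}
      (mem : ⟨q, x, .push z (some s), p⟩ ∈ P.transitions) :
      GrammarRule ⟨(q, z, none), x.toList.map .terminal ++ [.nonterminal (p, s, none)]⟩
  | push_pop {q p : P.State} {x : Option T} {z s : P.StackSymbol} (r : P.State)
      (o : Option P.State) (mem : ⟨q, x, .push z (some s), p⟩ ∈ P.transitions) :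
      GrammarRule ⟨(q, z, o), x.toList.map .terminal ++
        [.nonterminal (p, s, some r), .nonterminal (r, z, o)]⟩

variable {P} in
theorem GrammarRule.length_le {r : ContextFreeRule T P.Nonterminal} (h : P.GrammarRule r) :
    r.output.length ≤ 3 := by
  have hx : ∀ x : Option T, x.toList.length ≤ 1 := by rintro (_ | _) <;> simp
  cases h <;> simp <;> grind

/-- A right-hand side consists of at most one terminal and two nonterminals, hence is one of
finitely many strings of length at most 3. -/
theorem finite_grammarRule [Finite T] : {r | P.GrammarRule r}.Finite := by
  have := P.finite_state
  have := P.finite_stackSymbol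
  have : Finite (Symbol T P.Nonterminal) :=
    Finite.of_surjective (fun o : T ⊕ P.Nonterminal => o.elim .terminal .nonterminal) fun s =>
      match s with
      | .terminal a => ⟨.inl a, rfl⟩
      | .nonterminal n => ⟨.inr n, rfl⟩
  refine Set.Finite.subset ((Set.finite_univ.prod (List.finite_length_le _ 3)).image
    fun a : P.Nonterminal × List (Symbol T P.Nonterminal) => ⟨a.1, a.2⟩) ?_
  intro r hr
  exact ⟨(r.input, r.output), ⟨trivial, GrammarRule.length_le hr⟩, rfl⟩

/-- The context-free grammar that generates the language of `P`. -/
noncomputable def toGrammar [Finite T] : ContextFreeGrammar T where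
  NT := P.Nonterminal
  initial := (P.start, P.bottom, none)
  rules := P.finite_grammarRule.toFinset

variable {P}

theorem Run.append {q q' q'' : P.State} {γ γ' γ'' : List P.StackSymbol} {u v : List T}
    (h : P.Run q γ u q' γ') (h' : P.Run q' γ' v q'' γ'') : P.Run q γ (u ++ v) q'' γ'' := by
  induction h with
  | nil => exact h'
  | cons mem step _ ih =>
    rw [List.append_assoc]
    exact .cons mem step (ih h')

theorem Run.single {q p : P.State} {x : Option T} {op : PDAOp P.StackSymbol}
    {γ γ' : List P.StackSymbol} (mem : ⟨q, x, op, p⟩ ∈ P.transitions) (step : op.Applies γ γ') :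
    P.Run q γ x.toList p γ' := by
  simpa using Run.cons mem step (Run.nil p γ')

/-- The words that lead from `q` to `o`, removing the stack symbol `z`, or to acceptance. -/
def segment : P.Nonterminal → Language T
  | (q, z, some p) => {w | ∀ γ, P.Run q (z :: γ) w p γ}
  | (q, z, none) => {w | ∀ γ, ∃ p ∈ P.final, ∃ γ', P.Run q (z :: γ) w p γ'}

/-- The computation put in front leaves everything below the top symbol alone, so it extends both
kinds of segments. This serves the rules `stay` and `push_pop`, whose parameter `o` is arbitrary. -/
theorem mem_segment_of_run {q p : P.State} {z z' : P.StackSymbol} {o : Option P.State}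
    {u v : List T} (h : ∀ γ, P.Run q (z :: γ) u p (z' :: γ))
    (hv : v ∈ segment (p, z', o)) : u ++ v ∈ segment (q, z, o) := by
  cases o with
  | some r => exact fun γ => (h γ).append (hv γ)
  | none =>
    intro γ
    obtain ⟨r, hr, γ', h'⟩ := hv γ
    exact ⟨r, hr, γ', (h γ).append h'⟩

theorem prod_map_terminal {N : Type*} (I : N → Language T) (w : List T) :
    ((w.map .terminal).map
      (Symbol.rec (motive := fun _ => Language T) (fun a => {[a]}) I)).prod = {w} := by
  induction w with
  | nil => rfl
  | cons a w ih =>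
    rw [List.map_cons, List.map_cons, List.prod_cons, ih]
    ext v
    simp only [Language.mem_mul]
    constructor
    · rintro ⟨_, rfl, _, rfl, rfl⟩
      rfl
    · rintro rfl
      exact ⟨[a], rfl, w, rfl, rfl⟩

/-- Soundness of the construction: with `Yields.mem_prod`, every word derived from a nonterminal is
read by a computation of the corresponding kind. -/
theorem GrammarRule.mem_segment {r : ContextFreeRule T P.Nonterminal} (h : P.GrammarRule r)
    {w : List T}
    (hw : w ∈ (r.output.map
      (Symbol.rec (motive := fun _ => Language T) (fun a => {[a]}) segment)).prod) :
    w ∈ segment r.input := by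
  cases h with
  | final z hq =>
    obtain rfl : w = [] := hw
    exact fun γ => ⟨_, hq, _, .nil _ _⟩
  | pop mem =>
    rw [prod_map_terminal] at hw
    obtain rfl := hw
    exact fun γ => .single mem (.pop _ _)
  | stay o mem =>
    rw [List.map_append, List.prod_append, prod_map_terminal, List.map_singleton,
      List.prod_singleton] at hw
    obtain ⟨_, rfl, v, hv, rfl⟩ := hw
    exact mem_segment_of_run (fun γ => .single mem (.push _ none _)) hv
  | push mem =>
    rw [List.map_append, List.prod_append, prod_map_terminal, List.map_singleton,
      List.prod_singleton] at hw
    obtain ⟨_, rfl, v, hv, rfl⟩ := hw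
    intro γ
    -- A segment works above every stack, here above the old stack with its top symbol still in
    -- place.
    obtain ⟨p, hp, γ', h⟩ := hv (_ :: γ)
    exact ⟨p, hp, γ', Run.append (.single mem (.push _ (some _) _)) h⟩
  | push_pop r o mem =>
    rw [List.map_append, List.prod_append, prod_map_terminal, List.map_cons, List.prod_cons,
      List.map_singleton, List.prod_singleton] at hw
    obtain ⟨_, rfl, _, ⟨u, hu, v, hv, rfl⟩, rfl⟩ := hw
    change _ ++ (u ++ v) ∈ _
    rw [← List.append_assoc]
    exact mem_segment_of_run
      (fun γ => Run.append (.single mem (.push _ (some _) _)) (hu (_ :: γ))) hv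

variable [Finite T]

/-- A decomposition of the word `w` according to the removals of the symbols of the stack `γ` in
an accepting computation that begins in the state `q`. -/
inductive Decomposes : P.State → List P.StackSymbol → List T → Prop
  | last {q : P.State} {z : P.StackSymbol} {w : List T} (γ : List P.StackSymbol)
      (h : P.toGrammar.Yields [.nonterminal (q, z, none)] w) : Decomposes q (z :: γ) w
  | cons {q p : P.State} {z : P.StackSymbol} {u v : List T} {γ : List P.StackSymbol}
      (h : P.toGrammar.Yields [.nonterminal (q, z, some p)] u) (rest : Decomposes p γ v) :
      Decomposes q (z :: γ) (u ++ v)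

theorem GrammarRule.yields {i : P.Nonterminal} {x : Option T}
    {β : List (Symbol T P.Nonterminal)} (h : P.GrammarRule ⟨i, x.toList.map .terminal ++ β⟩)
    {w : List T} (hw : P.toGrammar.Yields β w) :
    P.toGrammar.Yields [.nonterminal i] (x.toList ++ w) := by
  have := ContextFreeGrammar.Yields.nonterminal (g := P.toGrammar)
    (P.finite_grammarRule.mem_toFinset.2 h)
    ((ContextFreeGrammar.yields_map_terminal x.toList).append hw) .nil
  simpa using this

/-- Completeness, by induction from the first transition: a decomposition of the remaining
computation is regrouped according to the symbol that was on top before. The bottom symbol is never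
popped, so the stack never becomes empty and some symbol is always left to absorb the rest of the
word. -/
theorem Run.decomposes {q q' : P.State} {γ γ' : List P.StackSymbol} {w : List T}
    (h : P.Run q γ w q' γ') (hq' : q' ∈ P.final) (hγ : γ.getLast? = some P.bottom) :
    Decomposes q γ w := by
  induction h with
  | nil q γ =>
    cases γ with
    | nil => simp at hγ
    | cons z γ =>
      exact .last γ (GrammarRule.yields (x := none) (β := []) (.final z hq') .nil)
  | @cons τ γ γ₁ γ₂ w q' mem step _ ih =>
    obtain ⟨q, x, op, p⟩ := τ
    specialize ih hq'
    cases step with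
    | push z s γ =>
      cases s with
      | none =>
        cases ih hγ with
        | last _ h => exact .last γ ((GrammarRule.stay none mem).yields h)
        | cons h rest =>
          rw [← List.append_assoc]
          exact .cons ((GrammarRule.stay _ mem).yields h) rest
      | some s =>
        cases ih (by simpa using hγ) with
        | last _ h => exact .last γ ((GrammarRule.push mem).yields h)
        | cons h rest =>
          -- The pushed symbol `s` is removed at some point; the two cases are whether the symbol
          -- `z` below it stays for good or is removed as well.
          cases rest with
          | last _ h' =>
            exact .last γ ((GrammarRule.push_pop _ _ mem).yields (h.append h'))
          | cons h' rest =>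
            rw [← List.append_assoc, ← List.append_assoc, List.append_assoc x.toList]
            exact .cons ((GrammarRule.push_pop _ _ mem).yields (h.append h')) rest
    | pop t =>
      have ht : t ≠ P.bottom := P.pop_ne_bottom _ mem t rfl
      -- The popped symbol is not the bottom one, so it is not the last entry of the stack.
      have hγ₁ : γ₁.getLast? = some P.bottom := by
        cases γ₁ with
        | nil => simp [ht] at hγ
        | cons z γ => simpa using hγ
      have h : P.toGrammar.Yields [.nonterminal (q, t, some p)] (x.toList ++ []) :=
        GrammarRule.yields (β := []) (by simpa using GrammarRule.pop mem) .nil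
      rw [List.append_nil] at h
      exact .cons h (ih hγ₁)

variable (P) in
theorem language_toGrammar : P.toGrammar.language = P.language := by
  ext w
  rw [ContextFreeGrammar.mem_language_iff_yields]
  constructor
  · intro h
    have := h.mem_prod segment fun r hr w hw =>
      GrammarRule.mem_segment (P.finite_grammarRule.mem_toFinset.1 hr) hw
    rw [List.map_singleton, List.prod_singleton] at this
    exact this []
  · rintro ⟨q, hq, γ, h⟩
    cases h.decomposes hq rfl with
    | last _ h => exact h
    -- Removing the bottom symbol would leave the empty stack, which has no decomposition.
    | cons _ rest => cases rest

end PDA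

/-! ### From grammars to automata without `up` -/

namespace TSA

variable {T : Type*} {A : TSA T}

theorem Run.append {q q' q'' : A.State}
    {S S' S'' : TreeStack A.TLabel} {τs σs : List A.Transition} (h : A.Run q S τs q' S')
    (h' : A.Run q' S' σs q'' S'') : A.Run q S (τs ++ σs) q'' S'' := by
  induction h with
  | nil => exact h'
  | cons mem holds step _ ih => exact .cons mem holds step (ih h')

theorem read_append (τs σs : List A.Transition) :
    A.read (τs ++ σs) = A.read τs ++ A.read σs :=
  List.filterMap_append

end TSA

namespace ContextFreeGrammar

variable {T : Type*} (g : ContextFreeGrammar T)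

/-- The strings that occur in leftmost derivations as unprocessed parts of right-hand sides. -/
def suffixes : Set (List (Symbol T g.NT)) :=
  {β | β <:+ [.nonterminal g.initial] ∨ ∃ r ∈ g.rules, β <:+ r.output}

theorem finite_suffixes : g.suffixes.Finite := by
  have hfin : ∀ α : List (Symbol T g.NT), {β | β <:+ α}.Finite := fun α =>
    (List.finite_toSet α.tails).subset fun β hβ => (List.mem_tails _ _).2 hβ
  refine ((hfin [.nonterminal g.initial]).union
    (g.rules.finite_toSet.biUnion fun r _ => hfin r.output)).subset ?_
  rintro β (h | ⟨r, hr, h⟩)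
  · exact Or.inl h
  · exact Or.inr (Set.mem_biUnion hr h)

variable {g} in
theorem mem_suffixes_of_cons {x : Symbol T g.NT} {β : List (Symbol T g.NT)}
    (h : x :: β ∈ g.suffixes) : β ∈ g.suffixes :=
  h.imp ((List.suffix_cons x β).trans ·)
    fun ⟨r, hr, h⟩ => ⟨r, hr, (List.suffix_cons x β).trans h⟩

/-- A type that names the elements of `g.suffixes`. -/
abbrev SuffixName : Type := Fin (Nat.card g.suffixes)

/-- The string with a given name. -/
noncomputable def suffix (k : g.SuffixName) : List (Symbol T g.NT) :=
  haveI := g.finite_suffixes.to_subtype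
  ((Finite.equivFin g.suffixes).symm k : g.suffixes)

variable {g} in
theorem exists_suffix_eq {β : List (Symbol T g.NT)} (h : β ∈ g.suffixes) :
    ∃ k, g.suffix k = β := by
  have := g.finite_suffixes.to_subtype
  exact ⟨Finite.equivFin g.suffixes ⟨β, h⟩, congrArg Subtype.val (Equiv.symm_apply_apply _ _)⟩

theorem suffix_mem (k : g.SuffixName) : g.suffix k ∈ g.suffixes := Subtype.prop _

/-- The transitions of the automaton that traverses the derivation trees of `g`. The state is the
part of a right-hand side that remains to be processed (`none` after the traversal), and the label
of a vertex is the part that remains to be processed after the return to its parent. -/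
inductive TSARule : TSTransition (Option g.SuffixName) g.SuffixName T → Prop
  | read {j k : g.SuffixName} {a : T} (h : g.suffix j = .terminal a :: g.suffix k) :
      TSARule ⟨some j, some a, .always, .id, some k⟩
  | expand {i j k : g.SuffixName} {r : ContextFreeRule T g.NT} (mem : r ∈ g.rules)
      (h : g.suffix j = .nonterminal r.input :: g.suffix k) (hi : g.suffix i = r.output) :
      TSARule ⟨some j, none, .always, .push (g.suffix k).length.succPNat k, some i⟩
  | down {j k : g.SuffixName} (h : g.suffix j = []) :
      TSARule ⟨some j, none, .eq (.lab k), .down, some k⟩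
  | accept {j : g.SuffixName} (h : g.suffix j = []) :
      TSARule ⟨some j, none, .eq .root, .id, none⟩

instance _root_.TSPredicate.finite {C : Type} [Finite C] : Finite (TSPredicate C) :=
  Finite.of_surjective
    (fun o : Option (TreeLabel C) => o.elim TSPredicate.always TSPredicate.eq) fun p =>
    match p with
    | .always => ⟨none, rfl⟩
    | .eq c => ⟨some c, rfl⟩

/-- The instructions form an infinite type, as the index of a `push` is any positive integer. In
these rules the index is a function of the label, so finitely many data encode a rule. -/
theorem finite_tsaRule [Finite T] : {τ | g.TSARule τ}.Finite := by
  let instr : Option (Option g.SuffixName) → TSInstruction g.SuffixName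
    | none => .id
    | some none => .down
    | some (some k) => .push (g.suffix k).length.succPNat k
  refine (Set.finite_range fun a : Option g.SuffixName × Option T × TSPredicate g.SuffixName ×
    Option (Option g.SuffixName) × Option g.SuffixName =>
      (⟨a.1, a.2.1, a.2.2.1, instr a.2.2.2.1, a.2.2.2.2⟩ : TSTransition _ _ T)).subset ?_
  rintro _ (_ | _ | _ | _)
  · exact ⟨(_, _, _, none, _), rfl⟩
  · exact ⟨(_, _, _, some (some _), _), rfl⟩
  · exact ⟨(_, _, _, some none, _), rfl⟩
  · exact ⟨(_, _, _, none, _), rfl⟩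

/-- The name of the string that consists of the initial nonterminal. -/
noncomputable def initialName : g.SuffixName :=
  (exists_suffix_eq (g := g) (β := [.nonterminal g.initial]) (Or.inl List.suffix_rfl)).choose

theorem suffix_initialName : g.suffix g.initialName = [.nonterminal g.initial] :=
  (exists_suffix_eq (g := g) (β := [.nonterminal g.initial])
    (Or.inl List.suffix_rfl)).choose_spec

/-- The tree stack automaton that traverses the derivation trees of `g`. -/
noncomputable def toTSA [Finite T] : TSA T where
  -- The strings live in the universe of `T`, whereas states and labels must lie in `Type`; hence
  -- the use of names.
  State := Option g.SuffixName
  TLabel := g.SuffixName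
  finite_state := inferInstance
  finite_label := inferInstance
  start := some g.initialName
  transitions := {τ | g.TSARule τ}
  finite_transitions := g.finite_tsaRule
  final := {none}

theorem toTSA_upFree [Finite T] : g.toTSA.UpFree := by
  rintro _ (_ | _ | _ | _) n h <;> cases h

variable {g}

/-- `Continues ξ ν β`: the labels of the vertices on the path from `ν` to the root form the
string `β`. -/
inductive Continues (ξ : LabelledTree g.SuffixName) : Address → List (Symbol T g.NT) → Prop
  | nil : Continues ξ [] []
  | snoc {ν : Address} {n : ℕ+} {k : g.SuffixName} {β : List (Symbol T g.NT)}
      (h : Continues ξ ν β) (hk : ξ.label (ν ++ [n]) = some (.lab k)) :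
      Continues ξ (ν ++ [n]) (g.suffix k ++ β)

theorem Continues.congr {ξ ξ' : LabelledTree g.SuffixName} {ν : Address}
    {β : List (Symbol T g.NT)} (h : Continues ξ ν β)
    (hξ : ∀ μ, μ <+: ν → ξ'.label μ = ξ.label μ) : Continues ξ' ν β := by
  induction h with
  | nil => exact .nil
  | snoc _ hk ih =>
    exact .snoc (ih fun μ hμ => hξ μ (hμ.trans (List.prefix_append _ _)))
      (by rw [hξ _ List.prefix_rfl, hk])

theorem Continues.dropLast {ξ : LabelledTree g.SuffixName} {ν : Address}
    {β : List (Symbol T g.NT)} {k : g.SuffixName} (h : Continues ξ ν β)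
    (hk : ξ.label ν = some (.lab k)) :
    ∃ γ, Continues ξ ν.dropLast γ ∧ β = g.suffix k ++ γ := by
  cases h with
  | nil => simp [(ξ.root_iff []).2 rfl] at hk
  | snoc h hk' =>
    rw [hk'] at hk
    cases hk
    exact ⟨_, by simpa using h, rfl⟩

variable [Finite T]

theorem _root_.TSA.Run.eq_nil_of_source {q q' : g.toTSA.State} {S S' : TreeStack g.toTSA.TLabel}
    {τs : List g.toTSA.Transition} (h : g.toTSA.Run q S τs q' S') (hq : q = none) : τs = [] := by
  cases h with
  | nil => rfl
  | cons mem => cases mem <;> cases hq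

/-- The word read by an accepting run is derived from the unprocessed string. -/
theorem yields_of_run {q q' : g.toTSA.State} {S S' : TreeStack g.toTSA.TLabel}
    {τs : List g.toTSA.Transition} (h : g.toTSA.Run q S τs q' S') (hq' : q' = none) :
    ∀ (j : g.SuffixName) (β : List (Symbol T g.NT)), q = some j →
      Continues S.tree S.pointer β → g.Yields (g.suffix j ++ β) (g.toTSA.read τs) := by
  induction h with
  | nil q S =>
    rintro j β rfl
    cases hq'
  | @cons τ S S₁ S₂ τs q' mem holds step rest ih =>
    intro j β hj hβ
    rw [TSA.read_cons]
    specialize ih hq'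
    cases mem with
    | @read j' k a h =>
      cases hj
      cases step
      rw [h]
      exact .terminal a (ih k β rfl hβ)
    | @expand i j' k r mem h hi =>
      cases hj
      obtain ⟨h0, ht, hp⟩ := TreeStack.push_eq_some_iff.1 step
      -- The new vertex adds its label to the pending string; the labels on the path below it are
      -- untouched, since the new address is longer than all of theirs.
      have hβ' : Continues S₁.tree S₁.pointer (g.suffix k ++ β) := by
        rw [hp]
        refine .snoc (hβ.congr fun μ hμ => ?_) (by rw [ht]; exact Function.update_self ..)
        rw [ht, Function.update_of_ne]
        rintro rfl
        simpa using hμ.length_le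
      have := ih i _ rfl hβ'
      rw [hi] at this
      obtain ⟨u, v, hu, hv, hw⟩ := this.exists_of_append
      rw [h, hw]
      exact Yields.nonterminal (v := v) mem hu hv
    | @down j' k h =>
      cases hj
      obtain ⟨h0, ht, hp⟩ := TreeStack.down_eq_some_iff.1 step
      -- The predicate checked by the rule identifies the label at the pointer, so the string
      -- resumed in the new state is exactly the first part of `β`.
      obtain ⟨γ, hγ, rfl⟩ := hβ.dropLast holds
      rw [h]
      refine ih k γ rfl ?_
      rw [hp]
      exact hγ.congr fun μ _ => by rw [ht]
    | @accept j' h =>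
      cases hj
      have hnil : S.pointer = [] := (S.tree.root_iff _).1 holds
      rw [hnil] at hβ
      have hβ' : β = [] := by
        generalize hν : ([] : Address) = ν at hβ
        cases hβ with
        | nil => rfl
        | snoc => simp at hν
      rw [h, hβ', rest.eq_nil_of_source rfl]
      exact .nil

/-- Every derivation can be traversed, provided that the vertex under the pointer has no child
with an index that is at most the length of the derived string. The traversal affects only the
subtrees at these children. -/
theorem Yields.exists_run {β : List (Symbol T g.NT)} {w : List T} (h : g.Yields β w) :
    ∀ (j : g.SuffixName) (S : TreeStack g.SuffixName), g.suffix j = β →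
      (∀ n : ℕ+, (n : ℕ) ≤ β.length → S.tree.label (S.pointer ++ [n]) = none) →
      ∃ (i : g.SuffixName) (τs : List g.toTSA.Transition) (S' : TreeStack g.SuffixName),
        g.suffix i = [] ∧ g.toTSA.Run (some j) S τs (some i) S' ∧ g.toTSA.read τs = w ∧
        S'.pointer = S.pointer ∧
        ∀ ν, (∀ n : ℕ+, (n : ℕ) ≤ β.length → ¬ S.pointer ++ [n] <+: ν) →
          S'.tree.label ν = S.tree.label ν := by
  induction h with
  | nil =>
    intro j S hj hS
    exact ⟨j, [], S, hj, .nil (A := g.toTSA) _ _, rfl, rfl, fun _ _ => rfl⟩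
  | @terminal a β w _ ih =>
    intro j S hj hS
    obtain ⟨k, rfl⟩ := exists_suffix_eq (mem_suffixes_of_cons (hj ▸ g.suffix_mem j))
    obtain ⟨i, τs, S', hi, hrun, hread, hp, hlab⟩ :=
      ih k S rfl fun n hn => hS n (hn.trans (Nat.le_succ _))
    refine ⟨i, _ :: τs, S', hi, .cons (A := g.toTSA) (TSARule.read hj) trivial rfl hrun, ?_, hp,
      fun ν hν => hlab ν fun n hn => hν n (hn.trans (Nat.le_succ _))⟩
    exact (TSA.read_cons (A := g.toTSA) _ τs).trans (congrArg _ hread)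
  | @nonterminal r β u v mem _ _ ihu ihv =>
    intro j S hj hS
    obtain ⟨k, rfl⟩ := exists_suffix_eq (mem_suffixes_of_cons (hj ▸ g.suffix_mem j))
    obtain ⟨m, hm⟩ := exists_suffix_eq (g := g) (Or.inr ⟨r, mem, List.suffix_rfl⟩)
    -- The index is the length of the string still to be processed, including the nonterminal being
    -- expanded: it is the largest index assumed free.
    set n : ℕ+ := (g.suffix k).length.succPNat
    have hn' : (n : ℕ) = (g.suffix k).length + 1 := rfl
    have hfree : S.tree.label (S.pointer ++ [n]) = none := hS n (by simp [hn'])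
    obtain ⟨S₁, h₁⟩ := TreeStack.exists_push hfree k
    obtain ⟨-, ht₁, hp₁⟩ := TreeStack.push_eq_some_iff.1 h₁
    -- The traversal of the new subtree alters labels only at least two levels below the old
    -- pointer, so it keeps the label `k` and the siblings of the new vertex.
    have hlen : ∀ l : ℕ+, ∀ ν : Address, ν.length ≤ S.pointer.length + 1 →
        ¬ S₁.pointer ++ [l] <+: ν := by
      intro l ν hν h
      have := h.length_le
      simp [hp₁] at this
      omega
    obtain ⟨i, τs, S₂, hi, hrun₂, hread₂, hp₂, ht₂⟩ := ihu m S₁ hm fun l _ => by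
      rw [ht₁, Function.update_of_ne (by simp [hp₁]), hp₁]
      exact LabelledTree.label_append_eq_none hfree _
    obtain ⟨S₃, h₃⟩ := TreeStack.exists_down (S := S₂) (by simp [hp₂, hp₁])
    obtain ⟨-, ht₃, hp₃⟩ := TreeStack.down_eq_some_iff.1 h₃
    rw [hp₂, hp₁, List.dropLast_concat] at hp₃
    have holds : S₂.tree.label S₂.pointer = some (.lab k) := by
      rw [hp₂, ht₂ _ fun l _ => hlen l _ (by simp [hp₁]), ht₁, hp₁, Function.update_self]
    obtain ⟨i', σs, S₄, hi', hrun₄, hread₄, hp₄, ht₄⟩ := ihv k S₃ rfl fun l hl => by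
      -- Later siblings have indices at most the length of the remaining string, which is less than
      -- `n`.
      have hne : l ≠ n := by
        rintro rfl
        omega
      rw [ht₃, hp₃, ht₂ _ fun l' _ => hlen l' _ (by simp), ht₁,
        Function.update_of_ne (by simpa using hne)]
      exact hS l (hl.trans (Nat.le_succ _))
    refine ⟨i', _ :: (τs ++ _ :: σs), S₄, hi',
      .cons (A := g.toTSA) (TSARule.expand mem hj hm) trivial h₁
        (hrun₂.append (.cons (A := g.toTSA) (TSARule.down hi) holds h₃ hrun₄)), ?_,
      hp₄.trans hp₃, fun ν hν => ?_⟩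
    · refine (TSA.read_cons (A := g.toTSA) _ _).trans ?_
      refine (TSA.read_append (A := g.toTSA) τs _).trans ?_
      exact congrArg₂ _ hread₂ ((TSA.read_cons (A := g.toTSA) _ σs).trans hread₄)
    · have hnν : ¬ S.pointer ++ [n] <+: ν := hν n (by simp [hn'])
      rw [ht₄ ν fun l hl => by rw [hp₃]; exact hν l (hl.trans (Nat.le_succ _)), ht₃,
        ht₂ ν fun l _ h => hnν (by rw [hp₁] at h; exact (List.prefix_append _ _).trans h), ht₁,
        Function.update_of_ne (by rintro rfl; exact hnν List.prefix_rfl)]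

variable (g) in
theorem language_toTSA : g.toTSA.language = g.language := by
  ext w
  rw [mem_language_iff_yields]
  constructor
  · rintro ⟨τs, ⟨q, hq, S, hrun⟩, rfl⟩
    have := yields_of_run hrun hq g.initialName [] rfl .nil
    rwa [suffix_initialName] at this
  · intro h
    obtain ⟨i, τs, S, hi, hrun, hread, hp, ht⟩ :=
      h.exists_run g.initialName (TreeStack.init _) g.suffix_initialName fun n _ => by
        simp [TreeStack.init, LabelledTree.single]
    -- The traversal ends with the pointer back at the root, where `accept` applies without reading
    -- anything.
    refine ⟨τs ++ [_], ⟨none, rfl, S, hrun.append (.cons (A := g.toTSA) (TSARule.accept hi)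
      ((S.tree.root_iff _).2 hp) rfl (.nil (A := g.toTSA) _ _))⟩, ?_⟩
    rw [TSA.read_append, hread]
    exact List.append_nil w

end ContextFreeGrammar

theorem mainTheorem8 {T : Type*} [Finite T] (L : Language T) :
    List.TFAE
      [ ∃ A : TSA T, A.IsRestricted 1 ∧ A.language = L,
        ∃ A : TSA T, A.UpFree ∧ A.language = L,
        ∃ P : PDA T, P.language = L,
        L.IsContextFree ] := by
  tfae_have 1 → 2 := by
    rintro ⟨A, hA, rfl⟩
    exact ⟨A.dropUp, TSA.dropUp_upFree, hA.language_dropUp⟩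
  tfae_have 2 → 1 := by
    rintro ⟨A, hA, rfl⟩
    exact ⟨A, hA.isRestricted, rfl⟩
  tfae_have 2 → 3 := by
    rintro ⟨A, hA, rfl⟩
    exact ⟨A.toPDA, hA.language_toPDA⟩
  tfae_have 3 → 4 := by
    rintro ⟨P, rfl⟩
    exact ⟨P.toGrammar, P.language_toGrammar⟩
  tfae_have 4 → 2 := by
    rintro ⟨g, rfl⟩
    exact ⟨g.toTSA, g.toTSA_upFree, g.language_toTSA⟩
  tfae_finish
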